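/- Let $d\ge 1$ and let $\nu$ be the law of a random variable $\eta$ with values in the positive integers ($\eta\ge 1$ a.s.). Suppose that for some $0<\delta<d$ and all sufficiently large $n$, \[ \mathbf P[\eta\ge (2d)^n]\ \ge\ n^{-\delta}. \] Consider the frog model on $\mathbb Z^d$ in which the numbers $(\eta_x)_{x\in\mathbb Z^d}$ of particles initially placed at the sites are i.i.d. with law $\nu$. At time $0$ exactly the particles at the origin are active and all others sleep. Active particles perform independent discrete-time simple random walks on $\mathbb Z^d$ (independent also of the $\eta_x$), and all particles of a site wake up and start walking as soon as an active particle visits that site. Formally, let $S^{x,i}$ be the walk, started at $x$, of the $i$-th particle of $x$ after it wakes up, let $t(x,z)=\min\{n\ge 0: S^{x,i}_n=z \text{ for some } i\le \eta_x\}$ (with $\min\emptyset=\infty$), and let $T(x,z)$ be the infimum of $\sum_{j=1}^k t(x_{j-1},x_j)$ over all finite sequences $x=x_0,x_1,\dots,x_k=z$ of sites. Put $\xi_n=\{y\in\mathbb Z^d: T(0,y)\le n\}$ and $\bar\xi_n=\bigcup_{x\in\xi_n}\bigl(x+(-\tfrac12,\tfrac12]^d\bigr)$. A non-empty compact convex set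 $A\subset\mathbb R^d$ is called the asymptotic shape if for every $0<\varepsilon<1$, almost surely, \[ (1-\varepsilon)A\ \subset\ \frac{\bar\xi_n}{n}\ \subset\ (1+\varepsilon)A\qquad\text{for all sufficiently large } n. \] Then the asymptotic shape $A_\eta$ exists, is unique, and equals the full $\ell^1$ unit ball $\mathcal D=\{x\in\mathbb R^d: |x^{(1)}|+\cdots+|x^{(d)}|\le 1\}$. -/

import Mathlib

open MeasureTheory ProbabilityTheory Filter
open scoped Pointwise

/-- Sites of the lattice `ℤ^d`. -/
abbrev Site (d : ℕ) : Type := Fin d → ℤ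

/-- The randomness driving the frog model on `ℤ^d` with i.i.d. initial particle numbers of law `ν`:
`η x` is the number of particles initially at `x`, and `X x i k` is the `k`-th jump of the
`i`-th particle of site `x` (only the particles `i < η x` are present). The particle numbers are
i.i.d., the jumps are i.i.d. uniform on the `2d` unit vectors `± e_j` of `ℤ^d`, and the two
families are independent of each other. -/
structure IsFrogSystem {d : ℕ} {Ω : Type*} [MeasurableSpace Ω] (P : Measure Ω) (ν : Measure ℕ)
    (η : Site d → Ω → ℕ) (X : Site d → ℕ → ℕ → Ω → Site d) : Prop where
  measurable_count : ∀ x, Measurable (η x)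
  measurable_step : ∀ x i k, Measurable (X x i k)
  law_count : ∀ x, P.map (η x) = ν
  law_step : ∀ x i k (v : Site d),
    P.real {ω | X x i k ω = v} = if ∑ j, |v j| = 1 then 1 / (2 * (d : ℝ)) else 0
  indep_count : iIndepFun η P
  indep_step : iIndepFun (fun p : Site d × ℕ × ℕ => X p.1 p.2.1 p.2.2) P
  indep_count_step : IndepFun (fun ω (x : Site d) => η x ω)
    (fun ω (p : Site d × ℕ × ℕ) => X p.1 p.2.1 p.2.2 ω) P

section Frog

variable {d : ℕ} {Ω : Type*} (η : Site d → Ω → ℕ) (X : Site d → ℕ → ℕ → Ω → Site d)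

/-- The simple random walk `S^{x,i}_n` of the `i`-th particle of site `x`, started at `x`;
`n` counts the steps made since the particle woke up. -/
def walk (x : Site d) (i n : ℕ) (ω : Ω) : Site d :=
  x + ∑ k ∈ Finset.range n, X x i k ω

/-- `t(x,z)`: the first time at which one of the `η x` particles of `x` visits `z`, counted
from the moment these particles wake up (`⊤` if this never happens). -/
noncomputable def hitTime (x z : Site d) (ω : Ω) : ℕ∞ :=
  ⨅ (i : ℕ) (_ : i < η x ω) (n : ℕ) (_ : walk X x i n ω = z), (n : ℕ∞)

/-- The passage time `T(x,z)`: the infimum of `t(x_0,x_1) + ⋯ + t(x_{k-1},x_k)` over all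
finite sequences of sites with `x_0 = x` and `x_k = z`. -/
noncomputable def passageTime (x z : Site d) (ω : Ω) : ℕ∞ :=
  ⨅ (k : ℕ) (p : ℕ → Site d) (_ : p 0 = x) (_ : p k = z),
    ∑ i ∈ Finset.range k, hitTime η X (p i) (p (i + 1)) ω

/-- `ξ_n`: the sites whose particles have been awakened by time `n`, when the particles awake at
time `0` are exactly those at the origin. -/
def awakeSites (n : ℕ) (ω : Ω) : Set (Site d) :=
  {y | passageTime η X 0 y ω ≤ (n : ℕ∞)}

/-- `ξ̄_n`: the union of the cubes `x + (-1/2, 1/2]^d`, `x ∈ ξ_n`. -/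
def awakeRegion (n : ℕ) (ω : Ω) : Set (Fin d → ℝ) :=
  {u | ∃ x ∈ awakeSites η X n ω, ∀ j, u j ∈ Set.Ioc ((x j : ℝ) - 1 / 2) ((x j : ℝ) + 1 / 2)}

/-- `A` is the asymptotic shape: a non-empty compact convex set such that, for every
`0 < ε < 1`, almost surely `(1 - ε) A ⊆ ξ̄_n / n ⊆ (1 + ε) A` for all large `n`. -/
def IsAsymptoticShape [MeasurableSpace Ω] (P : Measure Ω) (A : Set (Fin d → ℝ)) : Prop :=
  A.Nonempty ∧ Convex ℝ A ∧ IsCompact A ∧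
    ∀ ε : ℝ, 0 < ε → ε < 1 → ∀ᵐ ω ∂P, ∀ᶠ n : ℕ in atTop,
      (1 - ε) • A ⊆ (n : ℝ)⁻¹ • awakeRegion η X n ω ∧
        (n : ℝ)⁻¹ • awakeRegion η X n ω ⊆ (1 + ε) • A

end Frog

/-- The full diamond: the closed unit ball of the `ℓ¹` norm on `ℝ^d`. -/
def diamond (d : ℕ) : Set (Fin d → ℝ) :=
  {x | ∑ j, |x j| ≤ 1}

/-!
Why the shape is the full diamond. The inclusion `ξ̄_n ⊆ (1 + ε) n 𝒟` only says that walks have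
`ℓ¹` speed at most one (`norm1_sub_le_passageTime`). The other inclusion rests on the heavy tail of
the particle numbers, and needs no subadditive ergodic theorem.

A site with at least `(2d)^(2k)` particles wakes up every site within distance `k` as early as
possible: a shortest path of length `m ≤ k` is followed by each particle with probability
`(2d)^(-m)`, so that the chance that no particle follows it is at most `e^(-k)`
(`IsFrogSystem.measure_no_particle_le`). On the other hand, among `s ^ d` sites one with at least
`(2d)^(2Cs)` particles is missing with probability at most `exp (-c s^(d - δ))`
(`IsFrogSystem.eventually_measure_forall_lt_le`), since `δ < d`. Both bounds survive a union over
polynomially many sites, so Borel–Cantelli shows that almost surely, for all large `s`, every site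
`x` with coordinates at most `s ^ M` has within distance `d s` a site whose particles visit every
site at distance at most `C s` along a shortest path
(`IsFrogSystem.ae_eventually_exists_spreads`).

To start, follow one particle of the origin. It leaves `[-L, L]^d` before time `n` except with
probability `O (L ^ 2 / n)` (`measureReal_staysWithin_le`, by optional stopping of a squared
coordinate), so it visits `s ^ d` sites in polynomial time. The trajectory is independent of the
particle numbers, hence one of these sites, `x₀`, has at least `(2d)^(2Cs)` particles
(`IsFrogSystem.ae_eventually_exists_walk_rich`). From `x₀` on the argument is deterministic
(`eventually_passageTime_le`): spreading sites at the scales `2 ^ j k` wake up the ball of radius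
`d 2 ^ j k` about `x₀` by time `O (2 ^ j k)`, and at the scale that is a small multiple of `ε n`,
with `C` of order `1 / ε`, a single spreading site wakes up the ball of radius `(1 - ε) n` at unit
speed.

Uniqueness: two shapes satisfy `(1 - ε) A ⊆ (1 + ε) B` for all `ε`, and `B` is closed.
-/

/-! ### The `ℓ¹` norm on the lattice and nearest-neighbour paths -/

/-- The `ℓ¹` norm of a lattice site, as a natural number. -/
def norm1 {d : ℕ} (x : Site d) : ℕ := ∑ j, (x j).natAbs

section Norm1

variable {d : ℕ}

theorem norm1_zero : norm1 (0 : Site d) = 0 := by simp [norm1]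

theorem norm1_add_le (x y : Site d) : norm1 (x + y) ≤ norm1 x + norm1 y := by
  simp only [norm1, ← Finset.sum_add_distrib, Pi.add_apply]
  exact Finset.sum_le_sum fun j _ => Int.natAbs_add_le _ _

theorem norm1_neg (x : Site d) : norm1 (-x) = norm1 x := by simp [norm1]

theorem norm1_sub_comm (x y : Site d) : norm1 (x - y) = norm1 (y - x) := by
  rw [← norm1_neg, neg_sub]

theorem norm1_sub_le (x y z : Site d) : norm1 (x - z) ≤ norm1 (x - y) + norm1 (y - z) := by
  simpa using norm1_add_le (x - y) (y - z)

theorem cast_norm1 (x : Site d) : (norm1 x : ℤ) = ∑ j, |x j| := by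
  simp [norm1]

theorem cast_norm1_real (x : Site d) : (norm1 x : ℝ) = ∑ j, |(x j : ℝ)| := by
  have h := congrArg (fun m : ℤ => (m : ℝ)) (cast_norm1 x)
  push_cast at h
  exact h

theorem natAbs_le_norm1 (x : Site d) (j : Fin d) : (x j).natAbs ≤ norm1 x :=
  Finset.single_le_sum (f := fun j => (x j).natAbs) (fun _ _ => Nat.zero_le _) (Finset.mem_univ j)

theorem norm1_eq_zero {x : Site d} (h : norm1 x = 0) : x = 0 := by
  funext j
  have := natAbs_le_norm1 x j
  simp only [Pi.zero_apply]
  omega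

theorem norm1_sum_le {s : Finset ℕ} {f : ℕ → Site d} (h : ∀ k ∈ s, norm1 (f k) ≤ 1) :
    norm1 (∑ k ∈ s, f k) ≤ s.card := by
  classical
  induction s using Finset.induction_on with
  | empty => simp [norm1]
  | insert a s ha ih =>
    rw [Finset.sum_insert ha, Finset.card_insert_of_notMem ha]
    have h1 := h a (Finset.mem_insert_self a s)
    have h2 := ih fun k hk => h k (Finset.mem_insert_of_mem hk)
    have := norm1_add_le (f a) (∑ k ∈ s, f k)
    omega

theorem norm1_single (j : Fin d) (a : ℤ) : norm1 (Pi.single j a : Site d) = a.natAbs := by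
  unfold norm1
  rw [Finset.sum_eq_single j] <;> simp +contextual

/-- Every site is reached from the origin by a nearest-neighbour path of `ℓ¹`-minimal length. -/
theorem exists_steps_sum_eq (v : Site d) :
    ∃ f : ℕ → Site d, (∀ k < norm1 v, norm1 (f k) = 1) ∧
      ∑ k ∈ Finset.range (norm1 v), f k = v := by
  induction hn : norm1 v generalizing v with
  | zero => exact ⟨0, by simp, by simp [norm1_eq_zero hn]⟩
  | succ n ih =>
    obtain ⟨j, hj⟩ : ∃ j, v j ≠ 0 := by
      by_contra! h
      have : v = 0 := funext h
      simp [this, norm1_zero] at hn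
    set e : Site d := Pi.single j (v j).sign with he
    have he1 : norm1 e = 1 := by
      rw [he, norm1_single, Int.natAbs_sign_of_ne_zero hj]
    have hv : norm1 (v - e) = n := by
      have h1 : norm1 (v - e) + 1 = norm1 v := by
        unfold norm1
        rw [← Finset.add_sum_erase _ _ (Finset.mem_univ j),
          ← Finset.add_sum_erase _ (fun j => (v j).natAbs) (Finset.mem_univ j)]
        have h2 : ∑ i ∈ Finset.univ.erase j, ((v - e) i).natAbs
            = ∑ i ∈ Finset.univ.erase j, (v i).natAbs := by
          refine Finset.sum_congr rfl fun i hi => ?_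
          simp [he, Pi.single_eq_of_ne (Finset.ne_of_mem_erase hi)]
        have h3 : ((v - e) j).natAbs + 1 = (v j).natAbs := by
          simp only [he, Pi.sub_apply, Pi.single_eq_same]
          rcases lt_or_gt_of_ne hj with h | h
          · rw [Int.sign_eq_neg_one_of_neg h]; omega
          · rw [Int.sign_eq_one_of_pos h]; omega
        omega
      omega
    obtain ⟨f, hf1, hf2⟩ := ih (v - e) hv
    refine ⟨fun k => if k < n then f k else e, fun k hk => ?_, ?_⟩
    · by_cases h : k < n
      · simp [h, hf1 k h]
      · simp [h, he1]
    · rw [Finset.sum_range_succ, Finset.sum_congr rfl (g := f)]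
      · simp [hf2]
      · intro k hk
        simp [Finset.mem_range.1 hk]

end Norm1

/-! ### Passage times -/

section Deterministic

variable {d : ℕ} {Ω : Type*} {η : Site d → Ω → ℕ} {X : Site d → ℕ → ℕ → Ω → Site d} {ω : Ω}

theorem hitTime_le {x z : Site d} {i n : ℕ} (hi : i < η x ω) (h : walk X x i n ω = z) :
    hitTime η X x z ω ≤ n :=
  iInf₂_le_of_le i hi (iInf₂_le_of_le n h le_rfl)

theorem passageTime_zero_le (x : Site d) : passageTime η X x x ω ≤ 0 :=
  iInf₂_le_of_le 0 (fun _ => x) (iInf₂_le_of_le rfl rfl (by simp))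

theorem exists_of_passageTime_le {x z : Site d} {n : ℕ} (h : passageTime η X x z ω ≤ n) :
    ∃ (k : ℕ) (p : ℕ → Site d), p 0 = x ∧ p k = z ∧
      ∑ i ∈ Finset.range k, hitTime η X (p i) (p (i + 1)) ω ≤ n := by
  have h' : passageTime η X x z ω < ((n + 1 : ℕ) : ℕ∞) :=
    lt_of_le_of_lt h (by exact_mod_cast Nat.lt_succ_self n)
  simp only [passageTime, iInf_lt_iff] at h'
  obtain ⟨k, p, h0, hk, hs⟩ := h'
  refine ⟨k, p, h0, hk, ?_⟩
  push_cast at hs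
  exact ENat.lt_add_one_iff (ENat.natCast_ne_top n) |>.1 hs

theorem passageTime_le_add (x y z : Site d) :
    passageTime η X x z ω ≤ passageTime η X x y ω + hitTime η X y z ω := by
  rcases eq_or_ne (passageTime η X x y ω) ⊤ with h | h
  · simp [h]
  obtain ⟨n, hn⟩ := ENat.ne_top_iff_exists.1 h
  obtain ⟨k, p, h0, hk, hs⟩ := exists_of_passageTime_le (hn ▸ le_rfl : passageTime η X x y ω ≤ n)
  rw [← hn]
  refine le_trans ?_ (add_le_add_left hs _)
  refine iInf₂_le_of_le (k + 1) (fun i => if i ≤ k then p i else z)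
    (iInf₂_le_of_le (by simp [h0]) (by simp) ?_)
  rw [Finset.sum_range_succ]
  refine add_le_add (Finset.sum_le_sum fun i hi => ?_) (by simp [hk])
  have := Finset.mem_range.1 hi
  simp [this.le, Nat.succ_le_of_lt this]

theorem norm1_sub_le_hitTime (hstep : ∀ x i k, norm1 (X x i k ω) = 1) (x z : Site d) :
    (norm1 (z - x) : ℕ∞) ≤ hitTime η X x z ω := by
  refine le_iInf₂ fun i _ => le_iInf₂ fun n hn => ?_
  have : z - x = ∑ k ∈ Finset.range n, X x i k ω := by
    rw [← hn]; simp [walk]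
  rw [this]
  have := norm1_sum_le (s := Finset.range n) (f := fun k => X x i k ω)
    fun k _ => (hstep x i k).le
  rw [Finset.card_range] at this
  exact_mod_cast this

/-- Information travels at speed at most one in the `ℓ¹` norm. -/
theorem norm1_sub_le_passageTime (hstep : ∀ x i k, norm1 (X x i k ω) = 1) (x z : Site d) :
    (norm1 (z - x) : ℕ∞) ≤ passageTime η X x z ω := by
  refine le_iInf₂ fun k p => le_iInf₂ fun h0 hk => ?_
  subst h0 hk
  induction k with
  | zero => simp [norm1]
  | succ k ih =>
    rw [Finset.sum_range_succ]
    refine le_trans ?_ (add_le_add ih (norm1_sub_le_hitTime hstep (p k) (p (k + 1))))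
    have := norm1_sub_le (p (k + 1)) (p k) (p 0)
    rw [← Nat.cast_add]
    exact Nat.cast_le.2 (by omega)

/-- The particles of `y` jointly visit every site within `ℓ¹` distance `R` of `y` as early as
possible, that is, at a time equal to its distance from `y`. -/
def Spreads (η : Site d → Ω → ℕ) (X : Site d → ℕ → ℕ → Ω → Site d) (R : ℕ) (y : Site d)
    (ω : Ω) : Prop :=
  ∀ z, norm1 (z - y) ≤ R → hitTime η X y z ω ≤ norm1 (z - y)

theorem Spreads.passageTime_le {R T : ℕ} {y z : Site d} (h : Spreads η X R y ω)
    (hT : passageTime η X 0 y ω ≤ T) (hz : norm1 (z - y) ≤ R) :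
    passageTime η X 0 z ω ≤ (T + norm1 (z - y) : ℕ) := by
  push_cast
  exact (passageTime_le_add 0 y z).trans (add_le_add hT (h z hz))

section Growth

variable {C k T₀ : ℕ} {x₀ : Site d} (hC : 3 * d ≤ C) (hT : passageTime η X 0 x₀ ω ≤ T₀)
  (h0 : Spreads η X (C * k) x₀ ω)
  (hgrow : ∀ s, k ≤ s → ∃ y, norm1 (y - x₀) ≤ d * s ∧ Spreads η X (C * s) y ω)

include hC hT h0 hgrow

/-- Doubling: once a ball of radius `d * s` is awake, a spreading site inside it wakes up the
ball of twice the radius within `3 * d * s` further steps. -/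
theorem passageTime_le_of_dyadic (j : ℕ) (z : Site d) (hz : norm1 (z - x₀) ≤ d * (2 ^ j * k)) :
    passageTime η X 0 z ω ≤ (T₀ + 4 * (d * (2 ^ j * k)) : ℕ) := by
  induction j generalizing z with
  | zero =>
    simp only [pow_zero, one_mul] at hz ⊢
    have h1 : d * k ≤ C * k := Nat.mul_le_mul_right _ (by omega)
    refine (h0.passageTime_le hT (hz.trans h1)).trans ?_
    exact Nat.cast_le.2 (by omega)
  | succ j ih =>
    obtain ⟨y, hy, hsp⟩ := hgrow (2 ^ j * k) (Nat.le_mul_of_pos_left k (by positivity))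
    set s := 2 ^ j * k with hs
    have h2 : 2 ^ (j + 1) * k = 2 * s := by rw [hs]; ring
    rw [h2] at hz ⊢
    have h3 : 3 * (d * s) ≤ C * s := by
      rw [← mul_assoc]; exact Nat.mul_le_mul_right _ hC
    have h4 : d * (2 * s) = 2 * (d * s) := by ring
    have h5 : norm1 (z - y) ≤ 3 * (d * s) := by
      have := norm1_sub_le z x₀ y
      rw [norm1_sub_comm x₀ y] at this
      omega
    refine (hsp.passageTime_le (ih y hy) (h5.trans h3)).trans ?_
    exact Nat.cast_le.2 (by omega)

theorem passageTime_le_of_ball (j : ℕ) (z : Site d)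
    (hz : norm1 (z - x₀) + d * (2 ^ j * k) ≤ C * (2 ^ j * k)) :
    passageTime η X 0 z ω ≤ (T₀ + 5 * (d * (2 ^ j * k)) + norm1 (z - x₀) : ℕ) := by
  obtain ⟨y, hy, hsp⟩ := hgrow (2 ^ j * k) (Nat.le_mul_of_pos_left k (by positivity))
  have h1 := passageTime_le_of_dyadic hC hT h0 hgrow j y hy
  have h2 := norm1_sub_le z x₀ y
  rw [norm1_sub_comm x₀ y] at h2
  refine (hsp.passageTime_le h1 (by omega)).trans ?_
  exact Nat.cast_le.2 (by omega)

/-- Unit speed: with spreading sites at every scale, the awake region fills the `ℓ¹` ball of radius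
`(1 - ε) n` by time `n`. -/
theorem eventually_passageTime_le (hd : 0 < d) (hk : 0 < k) {ε : ℝ} (hε : 0 < ε)
    (hCε : 20 * d / ε ≤ C) :
    ∀ᶠ n : ℕ in atTop, ∀ z : Site d, (norm1 z : ℝ) ≤ (1 - ε) * n →
      passageTime η X 0 z ω ≤ n := by
  have hd' : (0 : ℝ) < d := by exact_mod_cast hd
  have hk' : (0 : ℝ) < k := by exact_mod_cast hk
  have hlim : Tendsto (fun n : ℕ => ε * (n : ℝ)) atTop atTop :=
    tendsto_natCast_atTop_atTop.const_mul_atTop hε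
  filter_upwards [hlim.eventually_ge_atTop (10 * d * k),
    hlim.eventually_ge_atTop (2 * (T₀ + norm1 x₀))] with n hn1 hn2 z hz
  -- the dyadic scale just below `ε n / (10 d)`
  obtain ⟨j, hj1, hj2⟩ := exists_nat_pow_near (x := ε * n / (10 * d * k)) (y := (2 : ℝ))
    (by rw [le_div_iff₀ (by positivity)]; linarith) (by norm_num)
  rw [le_div_iff₀ (by positivity)] at hj1
  rw [div_lt_iff₀ (by positivity), pow_succ] at hj2
  have hzx : (norm1 (z - x₀) : ℝ) ≤ norm1 z + norm1 x₀ := by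
    have := norm1_add_le z (-x₀)
    rw [norm1_neg, ← sub_eq_add_neg] at this
    exact_mod_cast this
  have hT0 : (0 : ℝ) ≤ T₀ := by positivity
  have hx0 : (0 : ℝ) ≤ norm1 x₀ := by positivity
  set S : ℝ := 2 ^ j * k with hS
  have e1 : 10 * d * S ≤ ε * n := by rw [hS]; linarith
  have e2 : ε * n ≤ 20 * d * S := by rw [hS]; linarith
  have e3 : (n : ℝ) ≤ C * S := by
    have h20 : (n : ℝ) ≤ 20 * d / ε * S := by
      rw [div_mul_eq_mul_div, le_div_iff₀ hε]; linarith
    exact h20.trans (mul_le_mul_of_nonneg_right hCε (by positivity))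
  have h1 := passageTime_le_of_ball hC hT h0 hgrow j z (by
    have : (norm1 (z - x₀) : ℝ) + d * (2 ^ j * k) ≤ C * (2 ^ j * k) := by
      rw [← hS]; linarith
    exact_mod_cast this)
  refine h1.trans (Nat.cast_le.2 ?_)
  have : (T₀ : ℝ) + 5 * (d * (2 ^ j * k)) + norm1 (z - x₀) ≤ n := by
    rw [← hS]; linarith
  exact_mod_cast this

end Growth

end Deterministic

/-! ### Particles of a rich site follow every shortest path -/

section Probability

variable {Ω : Type*} [MeasurableSpace Ω] {P : Measure Ω} [IsProbabilityMeasure P]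

/-- If each row of an independent array follows a given pattern `f` on its first `m` entries with
probability `q`, then all of the first `N` rows fail to do so with probability `(1 - q) ^ N`. -/
theorem measureReal_forall_exists_ne {α : Type*} [MeasurableSpace α] [Countable α]
    [MeasurableSingletonClass α] {Y : ℕ × ℕ → Ω → α} (hY : iIndepFun Y P)
    (hmeas : ∀ p, Measurable (Y p)) (f : ℕ → α) (m : ℕ) {q : ℝ}
    (hq : ∀ i, P.real {ω | ∀ k < m, Y (i, k) ω = f k} = q) (N : ℕ) :
    P.real {ω | ∀ i < N, ∃ k < m, Y (i, k) ω ≠ f k} = (1 - q) ^ N := by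
  induction N with
  | zero => simp
  | succ N ih =>
    have hdisj : Disjoint (Finset.range N ×ˢ Finset.range m) ({N} ×ˢ Finset.range m) := by
      rw [Finset.disjoint_left]
      rintro ⟨i, k⟩ h1 h2
      simp only [Finset.mem_product, Finset.mem_range, Finset.mem_singleton] at h1 h2
      omega
    have hind := hY.indepFun_finset _ _ hdisj hmeas
    have h := hind.measure_inter_preimage_eq_mul
      {u | ∀ i < N, ∃ k < m, ∃ h : (i, k) ∈ Finset.range N ×ˢ Finset.range m, u ⟨(i, k), h⟩ ≠ f k}
      {u | ∃ k < m, ∃ h : (N, k) ∈ {N} ×ˢ Finset.range m, u ⟨(N, k), h⟩ ≠ f k}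
      (MeasurableSet.of_discrete) (MeasurableSet.of_discrete)
    have e1 : (fun (a : Ω) (i : {x // x ∈ Finset.range N ×ˢ Finset.range m}) => Y (↑i) a) ⁻¹'
        {u | ∀ i < N, ∃ k < m, ∃ h : (i, k) ∈ Finset.range N ×ˢ Finset.range m,
          u ⟨(i, k), h⟩ ≠ f k} = {ω | ∀ i < N, ∃ k < m, Y (i, k) ω ≠ f k} := by
      ext ω
      simp only [Set.mem_preimage, Set.mem_ofPred_eq, Finset.mem_product, Finset.mem_range]
      refine forall₂_congr fun i hi => exists_congr fun k => and_congr_right fun hk => ?_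
      simp [hi, hk]
    have e2 : (fun (a : Ω) (i : {x // x ∈ {N} ×ˢ Finset.range m}) => Y (↑i) a) ⁻¹'
        {u | ∃ k < m, ∃ h : (N, k) ∈ {N} ×ˢ Finset.range m, u ⟨(N, k), h⟩ ≠ f k}
        = {ω | ∀ k < m, Y (N, k) ω = f k}ᶜ := by
      ext ω
      simp only [Set.mem_preimage, Set.mem_ofPred_eq, Finset.mem_product, Finset.mem_range,
        Finset.mem_singleton, Set.mem_compl_iff, not_forall]
      refine exists_congr fun k => ?_
      constructor
      · rintro ⟨hk, -, h⟩; exact ⟨hk, h⟩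
      · rintro ⟨hk, h⟩; exact ⟨hk, ⟨trivial, hk⟩, h⟩
    rw [e1, e2] at h
    have e3 : {ω | ∀ i < N + 1, ∃ k < m, Y (i, k) ω ≠ f k}
        = {ω | ∀ i < N, ∃ k < m, Y (i, k) ω ≠ f k} ∩ {ω | ∀ k < m, Y (N, k) ω = f k}ᶜ := by
      ext ω
      simp only [Set.mem_ofPred_eq, Set.mem_inter_iff, Set.mem_compl_iff, not_forall]
      rw [Nat.forall_lt_succ_right]
      simp
    have hms : MeasurableSet {ω | ∀ k < m, Y (N, k) ω = f k} := by
      simp only [Set.ofPred_forall]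
      exact MeasurableSet.iInter fun k => MeasurableSet.iInter fun _ =>
        hmeas (N, k) (measurableSet_singleton (f k))
    rw [e3, measureReal_def, h, ENNReal.toReal_mul, ← measureReal_def, ← measureReal_def, ih,
      probReal_compl_eq_one_sub hms, hq, pow_succ]

end Probability

section FrogSystem

variable {d : ℕ} {Ω : Type*} [MeasurableSpace Ω] {P : Measure Ω} {ν : Measure ℕ}
  {η : Site d → Ω → ℕ} {X : Site d → ℕ → ℕ → Ω → Site d}

namespace IsFrogSystem

theorem measureReal_step (hsys : IsFrogSystem P ν η X) (x : Site d) (i k : ℕ) {v : Site d}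
    (hv : norm1 v = 1) : P.real {ω | X x i k ω = v} = 1 / (2 * (d : ℝ)) := by
  rw [hsys.law_step, if_pos]
  rw [← cast_norm1, hv]; rfl

theorem iIndepFun_particles (hsys : IsFrogSystem P ν η X) (x : Site d) :
    iIndepFun (fun p : ℕ × ℕ => X x p.1 p.2) P :=
  hsys.indep_step.precomp (g := fun p : ℕ × ℕ => (x, p.1, p.2))
    fun p q h => by simpa [Prod.ext_iff] using h

theorem iIndepFun_steps (hsys : IsFrogSystem P ν η X) (x : Site d) (i : ℕ) :
    iIndepFun (fun k : ℕ => X x i k) P :=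
  hsys.indep_step.precomp (g := fun k : ℕ => (x, i, k)) fun p q h => by simpa using h

theorem measureReal_follow (hsys : IsFrogSystem P ν η X) (x : Site d) (i : ℕ) {f : ℕ → Site d}
    {m : ℕ} (hf : ∀ k < m, norm1 (f k) = 1) :
    P.real {ω | ∀ k < m, X x i k ω = f k} = (1 / (2 * (d : ℝ))) ^ m := by
  have h := (hsys.iIndepFun_steps x i).measure_inter_preimage_eq_mul (Finset.range m)
    (sets := fun k => {f k}) fun k _ => measurableSet_singleton _
  have e : {ω | ∀ k < m, X x i k ω = f k}
      = ⋂ k ∈ Finset.range m, X x i k ⁻¹' {f k} := by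
    ext ω; simp
  rw [e, measureReal_def, h, ENNReal.toReal_prod, ← Finset.card_range m, ← Finset.prod_const]
  rw [Finset.card_range]
  exact Finset.prod_congr rfl fun k hk => hsys.measureReal_step x i k (hf k (Finset.mem_range.1 hk))

variable [IsProbabilityMeasure P]

theorem ae_norm1_step (hsys : IsFrogSystem P ν η X) :
    ∀ᵐ ω ∂P, ∀ x i k, norm1 (X x i k ω) = 1 := by
  simp only [ae_all_iff]
  intro x i k
  have h : ∀ᵐ ω ∂P, ∀ v : Site d, norm1 v ≠ 1 → X x i k ω ≠ v := by
    rw [ae_all_iff]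
    intro v
    by_cases hv : norm1 v = 1
    · simp [hv]
    · have := hsys.law_step x i k v
      rw [if_neg (by rw [← cast_norm1]; exact_mod_cast hv), measureReal_eq_zero_iff] at this
      filter_upwards [measure_eq_zero_iff_ae_notMem.1 this] with ω hω _
      exact hω
  filter_upwards [h] with ω hω
  by_contra hne
  exact hω _ hne rfl

/-- Among `(2 * d) ^ (2 * k)` particles, the chance that none follows a prescribed path of length
at most `k` is tiny. -/
theorem measure_no_particle_le (hsys : IsFrogSystem P ν η X) (hd : 0 < d) (x v : Site d) {k : ℕ}
    (hv : norm1 v ≤ k) :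
    P {ω | ∀ i < (2 * d) ^ (2 * k), walk X x i (norm1 v) ω ≠ x + v}
      ≤ ENNReal.ofReal (Real.exp (-(k : ℝ))) := by
  obtain ⟨f, hf1, hf2⟩ := exists_steps_sum_eq v
  have h := measureReal_forall_exists_ne (hsys.iIndepFun_particles x)
    (fun p => hsys.measurable_step x p.1 p.2) f (norm1 v)
    (fun i => hsys.measureReal_follow x i hf1) ((2 * d) ^ (2 * k))
  have hd' : (1 : ℝ) ≤ d := by exact_mod_cast hd
  rw [ENNReal.le_ofReal_iff_toReal_le (measure_ne_top _ _) (Real.exp_pos _).le]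
  calc P.real {ω | ∀ i < (2 * d) ^ (2 * k), walk X x i (norm1 v) ω ≠ x + v}
      ≤ P.real {ω | ∀ i < (2 * d) ^ (2 * k), ∃ k < norm1 v, X x i k ω ≠ f k} := by
        refine measureReal_mono fun ω hω i hi => ?_
        by_contra! hc
        refine hω i hi ?_
        rw [walk, Finset.sum_congr rfl (g := f) fun k hk => hc k (Finset.mem_range.1 hk), hf2]
    _ = (1 - (1 / (2 * (d : ℝ))) ^ norm1 v) ^ ((2 * d) ^ (2 * k)) := h
    _ ≤ (Real.exp (-(1 / (2 * (d : ℝ))) ^ norm1 v)) ^ ((2 * d) ^ (2 * k)) := by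
        refine pow_le_pow_left₀ (sub_nonneg.2 (pow_le_one₀ (by positivity) ?_))
          (Real.one_sub_le_exp_neg _) _
        rw [div_le_one (by positivity)]; linarith
    _ ≤ Real.exp (-(k : ℝ)) := by
        rw [← Real.exp_nat_mul, Real.exp_le_exp, mul_neg, neg_le_neg_iff]
        have h1 : (1 / (2 * (d : ℝ))) ^ k ≤ (1 / (2 * (d : ℝ))) ^ norm1 v :=
          pow_le_pow_of_le_one (by positivity)
            (by rw [div_le_one (by positivity)]; linarith) hv
        have h2 : (2 * (d : ℝ)) ^ (2 * k) * (1 / (2 * (d : ℝ))) ^ k = (2 * (d : ℝ)) ^ k := by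
          rw [two_mul k, pow_add, mul_assoc, ← mul_pow, mul_one_div_cancel (by positivity),
            one_pow, mul_one]
        have h3 : (k : ℝ) ≤ (2 * (d : ℝ)) ^ k := by
          have : (k : ℝ) ≤ 2 ^ k := by exact_mod_cast Nat.lt_two_pow_self.le
          exact this.trans (pow_le_pow_left₀ (by norm_num) (by linarith) k)
        calc (k : ℝ) ≤ (2 * (d : ℝ)) ^ (2 * k) * (1 / (2 * (d : ℝ))) ^ k := by rw [h2]; exact h3
          _ ≤ ((2 * d) ^ (2 * k) : ℕ) * (1 / (2 * (d : ℝ))) ^ norm1 v := by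
            push_cast
            exact mul_le_mul_of_nonneg_left h1 (by positivity)

/-! ### Rich sites exist in every large set -/

theorem measure_forall_lt_le [IsProbabilityMeasure ν] (hsys : IsFrogSystem P ν η X)
    (S : Finset (Site d)) (N : ℕ) :
    P {ω | ∀ y ∈ S, η y ω < N}
      ≤ ENNReal.ofReal (Real.exp (-(S.card * ν.real {m | N ≤ m}))) := by
  have h := hsys.indep_count.measure_inter_preimage_eq_mul S
    (sets := fun _ => {m | N ≤ m}ᶜ) fun _ _ => MeasurableSet.of_discrete
  have e : {ω | ∀ y ∈ S, η y ω < N} = ⋂ y ∈ S, η y ⁻¹' {m | N ≤ m}ᶜ := by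
    ext ω; simp
  have hν : ∀ y, P (η y ⁻¹' {m | N ≤ m}ᶜ) = ν {m | N ≤ m}ᶜ := fun y => by
    rw [← hsys.law_count y, Measure.map_apply (hsys.measurable_count y) MeasurableSet.of_discrete]
  rw [ENNReal.le_ofReal_iff_toReal_le (measure_ne_top _ _) (Real.exp_pos _).le, e, h]
  simp only [hν, Finset.prod_const, ENNReal.toReal_pow]
  rw [← measureReal_def, probReal_compl_eq_one_sub MeasurableSet.of_discrete, ← mul_neg,
    Real.exp_nat_mul]
  exact pow_le_pow_left₀ (sub_nonneg.2 measureReal_le_one) (Real.one_sub_le_exp_neg _) _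

/-- Under the tail assumption with exponent `δ < d`, a set of `s ^ d` sites is very likely to
contain one with at least `(2 * d) ^ (2 * C * s)` particles. -/
theorem eventually_measure_forall_lt_le [IsProbabilityMeasure ν] (hsys : IsFrogSystem P ν η X)
    {δ : ℝ}
    (htail : ∀ᶠ n : ℕ in atTop, (n : ℝ) ^ (-δ) ≤ ν.real {m : ℕ | (2 * d) ^ n ≤ m})
    {C : ℕ} (hC : 0 < C) :
    ∀ᶠ s : ℕ in atTop, ∀ S : Finset (Site d), s ^ d ≤ S.card →
      P {ω | ∀ y ∈ S, η y ω < (2 * d) ^ (2 * (C * s))}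
        ≤ ENNReal.ofReal (Real.exp (-(2 * C : ℝ) ^ (-δ) * (s : ℝ) ^ ((d : ℝ) - δ))) := by
  have hlim : Tendsto (fun s : ℕ => 2 * (C * s)) atTop atTop :=
    tendsto_atTop_mono (fun s => by simp only [id]; nlinarith [Nat.zero_le s]) tendsto_id
  filter_upwards [hlim.eventually htail, eventually_gt_atTop 0] with s hs hs0 S hS
  refine (hsys.measure_forall_lt_le S _).trans (ENNReal.ofReal_le_ofReal ?_)
  rw [Real.exp_le_exp, neg_mul, neg_le_neg_iff]
  have hs0' : (0 : ℝ) < s := by exact_mod_cast hs0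
  have e : (2 * C : ℝ) ^ (-δ) * (s : ℝ) ^ ((d : ℝ) - δ)
      = (s : ℝ) ^ d * ((2 * (C * s) : ℕ) : ℝ) ^ (-δ) := by
    push_cast
    rw [← mul_assoc (2 : ℝ), Real.mul_rpow (by positivity) hs0'.le, sub_eq_add_neg,
      Real.rpow_add hs0', Real.rpow_natCast]
    ring
  rw [e]
  have hS' : (s : ℝ) ^ d ≤ S.card := by exact_mod_cast hS
  exact mul_le_mul hS' hs (by positivity) (by positivity)

end IsFrogSystem

end FrogSystem

/-! ### The range of a single walk -/

section Exit

section Defs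

variable {Ω : Type*}

/-- The partial sum `ζ 0 + ⋯ + ζ (n - 1)`. -/
def partialSum (ζ : ℕ → Ω → ℤ) (n : ℕ) (ω : Ω) : ℤ := ∑ k ∈ Finset.range n, ζ k ω

/-- The partial sums stay in `[-L, L]` up to time `n`. -/
def staysWithin (ζ : ℕ → Ω → ℤ) (L n : ℕ) : Set Ω := {ω | ∀ i ≤ n, |partialSum ζ i ω| ≤ L}

theorem staysWithin_anti {ζ : ℕ → Ω → ℤ} (L : ℕ) {m n : ℕ} (h : m ≤ n) :
    staysWithin ζ L n ⊆ staysWithin ζ L m := fun _ hω i hi => hω i (hi.trans h)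

end Defs

variable {Ω : Type*} [MeasurableSpace Ω] {P : Measure Ω}

/-- The value at time `j + 1` of an independent sequence is independent of its past. -/
theorem indepFun_past {α : Type*} [MeasurableSpace α] [Countable α]
    [MeasurableSingletonClass α] {Y : ℕ → Ω → α} (hY : iIndepFun Y P)
    (hmeas : ∀ k, Measurable (Y k)) (j : ℕ) {β γ : Type*} [MeasurableSpace β] [MeasurableSpace γ]
    {F : Ω → β} (hF : ∃ φ : (Finset.range j → α) → β, ∀ ω, F ω = φ fun i => Y i ω)
    (g : α → γ) : IndepFun F (fun ω => g (Y j ω)) P := by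
  obtain ⟨φ, hφ⟩ := hF
  have h := hY.indepFun_finset (Finset.range j) {j} (by simp) hmeas
  have h2 := h.comp (φ := φ) (ψ := fun u => g (u ⟨j, by simp⟩)) (measurable_of_countable _)
    (measurable_of_countable _)
  have e : F = φ ∘ fun ω (i : Finset.range j) => Y i ω := funext hφ
  rw [e]
  exact h2

variable [IsProbabilityMeasure P] {ζ : ℕ → Ω → ℤ}

theorem measurable_partialSum (hm : ∀ k, Measurable (ζ k)) (n : ℕ) :
    Measurable (partialSum ζ n) :=
  Finset.measurable_fun_sum _ fun k _ => hm k

theorem measurableSet_staysWithin (hm : ∀ k, Measurable (ζ k)) (L n : ℕ) :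
    MeasurableSet (staysWithin ζ L n) := by
  simp only [staysWithin, Set.ofPred_forall]
  exact MeasurableSet.iInter fun i => MeasurableSet.iInter fun _ =>
    measurable_partialSum hm i (MeasurableSet.of_discrete (s := {a : ℤ | |a| ≤ L}))

/-- A centred walk on `ℤ` with steps in `{-1, 0, 1}` of variance `σ` stays in `[-L, L]` up to
time `n` with probability at most `(L + 1) ^ 2 / (σ * n)`. The reason is that
`S_n ^ 2 - (L + 1) ^ 2`, killed when the walk leaves `[-L, L]`, gains `σ` in expectation at each
step before the exit, and takes its values in `[-(L + 1) ^ 2, 0]`. -/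
theorem measureReal_staysWithin_le (hind : iIndepFun ζ P) (hm : ∀ k, Measurable (ζ k))
    (hb : ∀ᵐ ω ∂P, ∀ k, |ζ k ω| ≤ 1) {σ : ℝ} (h1 : ∀ k, ∫ ω, (ζ k ω : ℝ) ∂P = 0)
    (h2 : ∀ k, ∫ ω, (ζ k ω : ℝ) ^ 2 ∂P = σ) (hσ : 0 ≤ σ) (L n : ℕ) :
    σ * n * P.real (staysWithin ζ L n) ≤ ((L : ℝ) + 1) ^ 2 := by
  classical
  set A := fun j => staysWithin ζ L j with hA
  have hAm : ∀ j, MeasurableSet (A j) := measurableSet_staysWithin hm L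
  set I : ℕ → Ω → ℝ := fun j => (A j).indicator 1 with hI
  have hIm : ∀ j, Measurable (I j) := fun j => measurable_one.indicator (hAm j)
  have hcast : Measurable (fun a : ℤ => (a : ℝ)) := measurable_of_countable _
  set S : ℕ → Ω → ℝ := fun j ω => (partialSum ζ j ω : ℝ) with hS
  have hSm : ∀ j, Measurable (S j) := fun j => hcast.comp (measurable_partialSum hm j)
  have hzm : ∀ j, Measurable (fun ω => (ζ j ω : ℝ)) := fun j => hcast.comp (hm j)
  have hSL : ∀ j ω, ω ∈ A j → |S j ω| ≤ L := fun j ω h => by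
    have := h j le_rfl
    simp only [hS]
    exact_mod_cast this
  have hI01 : ∀ j ω, |I j ω| ≤ 1 := fun j ω => by
    by_cases h : ω ∈ A j <;> simp [hI, h]
  have hbr : ∀ᵐ ω ∂P, ∀ k, |(ζ k ω : ℝ)| ≤ 1 := by
    filter_upwards [hb] with ω hω k
    exact_mod_cast hω k
  set φ : ℕ → Ω → ℝ := fun j ω => I j ω * (S j ω ^ 2 - ((L : ℝ) + 1) ^ 2) with hφ
  have hIS : ∀ j ω, |I j ω * S j ω| ≤ L := fun j ω => by
    by_cases h : ω ∈ A j
    · simpa [hI, h] using hSL j ω h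
    · simp [hI, h]
  have hφb : ∀ j ω, -((L : ℝ) + 1) ^ 2 ≤ φ j ω ∧ φ j ω ≤ 0 := fun j ω => by
    by_cases h : ω ∈ A j
    · have h3 := abs_le.1 (hSL j ω h)
      have h4 : S j ω ^ 2 ≤ ((L : ℝ) + 1) ^ 2 := by nlinarith
      simp only [hφ, hI, Set.indicator_of_mem h, Pi.one_apply, one_mul]
      constructor <;> nlinarith [sq_nonneg (S j ω)]
    · simp only [hφ, hI, Set.indicator_of_notMem h, zero_mul]
      exact ⟨by nlinarith, le_rfl⟩
  have hφi : ∀ j, Integrable (φ j) P := fun j =>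
    Integrable.of_bound ((hIm j).mul (((hSm j).pow_const 2).sub_const _)).aestronglyMeasurable
      (((L : ℝ) + 1) ^ 2) (ae_of_all _ fun ω => by
        rw [Real.norm_eq_abs, abs_le]
        exact ⟨(hφb j ω).1, (hφb j ω).2.trans (by positivity)⟩)
  -- the indicator and the partial sum at time `j` depend on the first `j` steps only
  have hpast : ∀ j i, i ≤ j → ∀ ω, partialSum ζ i ω
      = ∑ k ∈ Finset.range i, if h : k ∈ Finset.range j then
        (fun i : Finset.range j => ζ i ω) ⟨k, h⟩ else 0 := fun j i hij ω =>
    Finset.sum_congr rfl fun k hk => by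
      have : k < j := (Finset.mem_range.1 hk).trans_le hij
      simp [this]
  have hpastI : ∀ j, ∃ ψ : (Finset.range j → ℤ) → ℝ, ∀ ω, I j ω = ψ fun i => ζ i ω := fun j => by
    refine ⟨fun u => if ∀ i ≤ j, |∑ k ∈ Finset.range i,
      if h : k ∈ Finset.range j then u ⟨k, h⟩ else 0| ≤ (L : ℤ) then 1 else 0, fun ω => ?_⟩
    have : ω ∈ A j ↔ ∀ i ≤ j, |∑ k ∈ Finset.range i, if h : k ∈ Finset.range j then
        (fun i : Finset.range j => ζ i ω) ⟨k, h⟩ else 0| ≤ (L : ℤ) :=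
      forall₂_congr fun i hi => by rw [hpast j i hi ω]
    simp only [hI, Set.indicator_apply, this, Pi.one_apply]
  have hpastIS : ∀ j, ∃ ψ : (Finset.range j → ℤ) → ℝ, ∀ ω, I j ω * S j ω = ψ fun i => ζ i ω := by
    intro j
    obtain ⟨ψ, hψ⟩ := hpastI j
    refine ⟨fun u => ψ u * ((∑ k ∈ Finset.range j,
      if h : k ∈ Finset.range j then u ⟨k, h⟩ else 0 : ℤ) : ℝ), fun ω => ?_⟩
    simp only [hψ, hS, hpast j j le_rfl ω]
  have hcross : ∀ j, ∫ ω, (I j ω * S j ω) * (ζ j ω : ℝ) ∂P = 0 := fun j => by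
    rw [IndepFun.integral_fun_mul_eq_mul_integral
      (indepFun_past hind hm j (hpastIS j) (fun a : ℤ => (a : ℝ)))
      ((hIm j).mul (hSm j)).aestronglyMeasurable (hzm j).aestronglyMeasurable, h1, mul_zero]
  have hsq : ∀ j, ∫ ω, I j ω * (ζ j ω : ℝ) ^ 2 ∂P = P.real (A j) * σ := fun j => by
    rw [IndepFun.integral_fun_mul_eq_mul_integral
      (indepFun_past hind hm j (hpastI j) (fun a : ℤ => (a : ℝ) ^ 2))
      (hIm j).aestronglyMeasurable ((hzm j).pow_const 2).aestronglyMeasurable, h2]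
    congr 1
    exact integral_indicator_one (hAm j)
  have hcrossi : ∀ j, Integrable (fun ω => (I j ω * S j ω) * (ζ j ω : ℝ)) P := fun j =>
    Integrable.of_bound (((hIm j).mul (hSm j)).mul (hzm j)).aestronglyMeasurable (L * 1) (by
      filter_upwards [hbr] with ω hω
      rw [Real.norm_eq_abs, abs_mul]
      exact mul_le_mul (hIS j ω) (hω j) (abs_nonneg _) (by positivity))
  have hsqi : ∀ j, Integrable (fun ω => I j ω * (ζ j ω : ℝ) ^ 2) P := fun j =>
    Integrable.of_bound ((hIm j).mul ((hzm j).pow_const 2)).aestronglyMeasurable (1 * 1 ^ 2) (by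
      filter_upwards [hbr] with ω hω
      rw [Real.norm_eq_abs, abs_mul, abs_pow]
      exact mul_le_mul (hI01 j ω) (pow_le_pow_left₀ (abs_nonneg _) (hω j) 2) (by positivity)
        zero_le_one)
  have hinc : ∀ j, (∫ ω, φ j ω ∂P) + P.real (A j) * σ ≤ ∫ ω, φ (j + 1) ω ∂P := fun j => by
    have e : ∫ ω, (φ j ω + 2 * ((I j ω * S j ω) * (ζ j ω : ℝ)) + I j ω * (ζ j ω : ℝ) ^ 2) ∂P
        = (∫ ω, φ j ω ∂P) + P.real (A j) * σ := by
      rw [integral_add (f := fun ω => φ j ω + 2 * ((I j ω * S j ω) * (ζ j ω : ℝ)))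
          ((hφi j).add ((hcrossi j).const_mul 2)) (hsqi j),
        integral_add (hφi j) ((hcrossi j).const_mul 2), integral_const_mul, hcross, hsq]
      ring
    rw [← e]
    refine integral_mono_ae (((hφi j).add ((hcrossi j).const_mul 2)).add (hsqi j)) (hφi (j + 1)) ?_
    filter_upwards [hbr] with ω hω
    have hS1 : S (j + 1) ω = S j ω + ζ j ω := by
      simp [hS, partialSum, Finset.sum_range_succ]
    by_cases h : ω ∈ A j
    · have h3 := abs_le.1 (hSL j ω h)
      have h4 := abs_le.1 (hω j)
      by_cases h' : ω ∈ A (j + 1)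
      · simp only [hφ, hI, Set.indicator_of_mem h, Set.indicator_of_mem h', Pi.one_apply, hS1]
        nlinarith
      · simp only [hφ, hI, Set.indicator_of_mem h, Set.indicator_of_notMem h', Pi.one_apply]
        have h5 : (S j ω + ζ j ω) ^ 2 ≤ ((L : ℝ) + 1) ^ 2 :=
          sq_le_sq' (by linarith) (by linarith)
        nlinarith
    · have h' : ω ∉ A (j + 1) := fun hc => h (staysWithin_anti L (Nat.le_succ j) hc)
      simp [hφ, hI, h, h']
  have hsum : ∀ m ≤ n, -((L : ℝ) + 1) ^ 2 + m * (P.real (A n) * σ) ≤ ∫ ω, φ m ω ∂P := by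
    intro m hmn
    induction m with
    | zero =>
      have := integral_mono (integrable_const (-((L : ℝ) + 1) ^ 2)) (hφi 0) fun ω => (hφb 0 ω).1
      simpa using this
    | succ m ih =>
      have h3 := ih (by omega)
      have h4 := hinc m
      have h5 : P.real (A n) ≤ P.real (A m) :=
        measureReal_mono (staysWithin_anti L (by omega))
      have h6 := mul_le_mul_of_nonneg_right h5 hσ
      push_cast
      linarith
  have h3 := hsum n le_rfl
  have h4 : ∫ ω, φ n ω ∂P ≤ 0 := integral_nonpos fun ω => (hφb n ω).2
  have : A n = staysWithin ζ L n := rfl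
  rw [← this]
  linarith

end Exit

/-- A lattice path on `ℤ` with steps in `{-1, 0, 1}` that leaves `[-L, L]` has more than `L`
distinct values. -/
theorem card_image_of_exists_lt {S : ℕ → ℤ} (h0 : S 0 = 0) (hS : ∀ k, |S (k + 1) - S k| ≤ 1)
    {L n : ℕ} (h : ∃ i ≤ n, (L : ℤ) < |S i|) :
    L < ((Finset.range (n + 1)).image S).card := by
  have hsub : Finset.range (L + 1) ⊆
      ((Finset.range (n + 1)).image S).image Int.natAbs := by
    intro l hl
    rw [Finset.mem_range] at hl
    obtain ⟨i, hin, hi⟩ := h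
    rw [Int.abs_eq_natAbs] at hi
    have hex : ∃ i, l ≤ (S i).natAbs := ⟨i, by omega⟩
    obtain ⟨r, hr, hmin⟩ : ∃ r, l ≤ (S r).natAbs ∧ ∀ m < r, ¬ l ≤ (S m).natAbs :=
      ⟨Nat.find hex, Nat.find_spec hex, fun m hm => Nat.find_min hex hm⟩
    have hri : r ≤ i := by
      by_contra! hlt
      exact hmin i hlt (by omega)
    rw [Finset.image_image, Finset.mem_image]
    refine ⟨r, Finset.mem_range.2 (by omega), ?_⟩
    simp only [Function.comp]
    rcases r with _ | k
    · rw [h0] at hr ⊢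
      simp only [Int.natAbs_zero] at hr ⊢
      omega
    · have h3 := hmin k (by omega)
      have := hS k
      rw [Int.abs_eq_natAbs] at this
      omega
  have := (Finset.card_le_card hsub).trans Finset.card_image_le
  rw [Finset.card_range] at this
  omega

section FrogSystem

variable {d : ℕ} {Ω : Type*} [MeasurableSpace Ω] {P : Measure Ω} {ν : Measure ℕ}
  {η : Site d → Ω → ℕ} {X : Site d → ℕ → ℕ → Ω → Site d} [IsProbabilityMeasure P]

namespace IsFrogSystem

theorem integral_step_coord (hsys : IsFrogSystem P ν η X) (x : Site d) (i k : ℕ) (j : Fin d) :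
    ∫ ω, ((X x i k ω j : ℤ) : ℝ) ∂P = 0 ∧ ∫ ω, ((X x i k ω j : ℤ) : ℝ) ^ 2 ∂P = 1 / d := by
  classical
  have hms : ∀ v, MeasurableSet {ω | X x i k ω = v} := fun v =>
    hsys.measurable_step x i k (measurableSet_singleton v)
  set e : Site d := Pi.single j 1 with he
  set e' : Site d := Pi.single j (-1) with he'
  set U := {ω | X x i k ω = e}
  set V := {ω | X x i k ω = e'}
  have hU : P.real U = 1 / (2 * (d : ℝ)) := hsys.measureReal_step x i k (by simp [he, norm1_single])
  have hV : P.real V = 1 / (2 * (d : ℝ)) :=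
    hsys.measureReal_step x i k (by simp [he', norm1_single])
  have hUi : Integrable (U.indicator (1 : Ω → ℝ)) P := (integrable_const 1).indicator (hms _)
  have hVi : Integrable (V.indicator (1 : Ω → ℝ)) P := (integrable_const 1).indicator (hms _)
  have hval : ∀ᵐ ω ∂P, (((X x i k ω j : ℤ) : ℝ) = U.indicator 1 ω - V.indicator 1 ω) ∧
      (((X x i k ω j : ℤ) : ℝ) ^ 2 = U.indicator 1 ω + V.indicator 1 ω) := by
    filter_upwards [hsys.ae_norm1_step] with ω hω
    have hs := hω x i k
    have hee : e ≠ e' := fun h => by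
      have := congrFun h j
      simp [he, he'] at this
    have hoth : ∀ a : ℤ, a.natAbs = 1 → X x i k ω j = a → X x i k ω = Pi.single j a := by
      intro a ha hja
      have h1 : norm1 (X x i k ω) = (X x i k ω j).natAbs
          + ∑ l ∈ Finset.univ.erase j, (X x i k ω l).natAbs :=
        (Finset.add_sum_erase _ _ (Finset.mem_univ j)).symm
      have h2 : ∑ l ∈ Finset.univ.erase j, (X x i k ω l).natAbs = 0 := by
        rw [hja] at h1; omega
      rw [Finset.sum_eq_zero_iff] at h2
      funext l
      by_cases hl : l = j
      · subst hl; simp [hja]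
      · have := h2 l (by simp [hl])
        simp [hl]; omega
    have hj := natAbs_le_norm1 (X x i k ω) j
    rw [hs] at hj
    have h3 : X x i k ω j = 0 ∨ X x i k ω j = 1 ∨ X x i k ω j = -1 := by omega
    rcases h3 with h | h | h
    · have hu : ω ∉ U := fun hc => by
        have := congrFun (show X x i k ω = e from hc) j
        simp [he, h] at this
      have hv : ω ∉ V := fun hc => by
        have := congrFun (show X x i k ω = e' from hc) j
        simp [he', h] at this
      simp [hu, hv, h]
    · have hu : ω ∈ U := hoth 1 rfl h
      have hv : ω ∉ V := fun hc => hee ((show X x i k ω = e from hu).symm.trans hc)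
      simp [hu, hv, h]
    · have hv : ω ∈ V := hoth (-1) rfl h
      have hu : ω ∉ U := fun hc => hee ((show X x i k ω = e from hc).symm.trans hv)
      simp [hu, hv, h]
  constructor
  · rw [integral_congr_ae (hval.mono fun ω h => h.1), integral_sub hUi hVi,
      integral_indicator_one (hms _), integral_indicator_one (hms _)]
    simp only [U, V] at hU hV
    rw [hU, hV, sub_self]
  · rw [integral_congr_ae (hval.mono fun ω h => h.2), integral_add hUi hVi,
      integral_indicator_one (hms _), integral_indicator_one (hms _)]
    simp only [U, V] at hU hV
    rw [hU, hV]
    field_simp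
    norm_num

/-- With high probability a single particle visits more than `L` sites up to time `n`, as soon as
`n` is much larger than `L ^ 2`. -/
theorem measure_card_range_le (hsys : IsFrogSystem P ν η X) (hd : 0 < d) (x : Site d) (i : ℕ)
    {L n : ℕ} (hn : 0 < n) :
    P {ω | ((Finset.range (n + 1)).image fun m => walk X x i m ω).card ≤ L}
      ≤ ENNReal.ofReal (d * ((L : ℝ) + 1) ^ 2 / n) := by
  classical
  set j : Fin d := ⟨0, hd⟩
  set ζ : ℕ → Ω → ℤ := fun k ω => X x i k ω j with hζ
  have hm : ∀ k, Measurable (ζ k) := fun k =>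
    (measurable_pi_apply j).comp (hsys.measurable_step x i k)
  have hind : iIndepFun ζ P :=
    (hsys.iIndepFun_steps x i).comp (fun _ v => v j) fun _ => measurable_pi_apply j
  have hb : ∀ᵐ ω ∂P, ∀ k, |ζ k ω| ≤ 1 := by
    filter_upwards [hsys.ae_norm1_step] with ω hω k
    have hj' := natAbs_le_norm1 (X x i k ω) j
    rw [hω] at hj'
    rw [Int.abs_eq_natAbs]
    exact_mod_cast hj'
  have hd' : (0 : ℝ) < d := by exact_mod_cast hd
  have hn' : (0 : ℝ) < n := by exact_mod_cast hn
  have h := measureReal_staysWithin_le hind hm hb (fun k => (hsys.integral_step_coord x i k j).1)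
    (fun k => (hsys.integral_step_coord x i k j).2) (by positivity) L n
  have hle : P {ω | ((Finset.range (n + 1)).image fun m => walk X x i m ω).card ≤ L}
      ≤ P (staysWithin ζ L n) := by
    refine measure_mono_ae ?_
    filter_upwards [hb] with ω hω hcard i' hi'
    by_contra! hlt
    have h1 : L < ((Finset.range (n + 1)).image fun m => partialSum ζ m ω).card := by
      refine card_image_of_exists_lt (by simp [partialSum]) (fun k => ?_) ⟨i', hi', hlt⟩
      simpa [partialSum, Finset.sum_range_succ] using hω k
    have h2 : ((Finset.range (n + 1)).image fun m => partialSum ζ m ω)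
        = ((Finset.range (n + 1)).image fun m => walk X x i m ω).image fun v => v j - x j := by
      rw [Finset.image_image]
      refine Finset.image_congr fun m _ => ?_
      simp [walk, partialSum, hζ]
    rw [h2] at h1
    have h3 : ((Finset.range (n + 1)).image fun m => walk X x i m ω).card ≤ L := hcard
    exact absurd (h1.trans_le Finset.card_image_le) (not_lt.2 h3)
  refine hle.trans ?_
  rw [ENNReal.le_ofReal_iff_toReal_le (measure_ne_top _ _) (by positivity), ← measureReal_def,
    le_div_iff₀ hn']
  have e : 1 / (d : ℝ) * n * P.real (staysWithin ζ L n)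
      = P.real (staysWithin ζ L n) * n / d := by ring
  rw [e, div_le_iff₀ hd'] at h
  linarith

end IsFrogSystem

end FrogSystem

/-! ### Borel–Cantelli over polynomially many events -/

theorem summable_pow_mul_exp_neg_rpow (m : ℕ) {c β : ℝ} (hc : 0 < c) (hβ : 0 < β) :
    Summable fun s : ℕ => (s : ℝ) ^ m * Real.exp (-c * (s : ℝ) ^ β) := by
  have h1 : Tendsto (fun s : ℕ => (s : ℝ) ^ β) atTop atTop :=
    (tendsto_rpow_atTop hβ).comp tendsto_natCast_atTop_atTop
  have h2 := ((isLittleO_exp_neg_mul_rpow_atTop hc (-((m : ℝ) + 2) / β)).comp_tendsto h1).isBigO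
  have h3 := (Asymptotics.isBigO_refl (fun s : ℕ => (s : ℝ) ^ m) atTop).mul h2
  refine summable_of_isBigO_nat (Real.summable_nat_pow_inv.2 one_lt_two) (h3.congr' ?_ ?_)
  · exact Eventually.of_forall fun s => rfl
  · filter_upwards [eventually_gt_atTop 0] with s hs
    have hs' : (0 : ℝ) < s := by exact_mod_cast hs
    simp only [Function.comp]
    rw [← Real.rpow_mul hs'.le, mul_div_cancel₀ _ hβ.ne', ← Real.rpow_natCast,
      ← Real.rpow_add hs', ← Real.rpow_natCast, ← Real.rpow_neg hs'.le]
    congr 1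
    push_cast
    ring

section BorelCantelli

variable {Ω : Type*} [MeasurableSpace Ω] {P : Measure Ω}

/-- Borel–Cantelli: a union bound over polynomially many events of stretched-exponentially small
probability. -/
theorem ae_eventually_forall_notMem {ι : Type*} (I : ℕ → Finset ι) (E : ℕ → ι → Set Ω) {K : ℝ}
    {m : ℕ} (hcard : ∀ᶠ s : ℕ in atTop, ((I s).card : ℝ) ≤ K * (s : ℝ) ^ m) {c β : ℝ} (hc : 0 < c)
    (hβ : 0 < β) (hE : ∀ᶠ s : ℕ in atTop, ∀ i ∈ I s,
      P (E s i) ≤ ENNReal.ofReal (Real.exp (-c * (s : ℝ) ^ β))) :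
    ∀ᵐ ω ∂P, ∀ᶠ s in atTop, ∀ i ∈ I s, ω ∉ E s i := by
  classical
  obtain ⟨s₀, hs₀⟩ := eventually_atTop.1 (hcard.and hE)
  set B : ℕ → Set Ω := fun s => if s₀ ≤ s then ⋃ i ∈ I s, E s i else ∅ with hB
  have hle : ∀ s, P (B s) ≤
      ENNReal.ofReal (K * ((s : ℝ) ^ m * Real.exp (-c * (s : ℝ) ^ β))) := fun s => by
    by_cases hs : s₀ ≤ s
    · simp only [hB, hs, if_true]
      calc P (⋃ i ∈ I s, E s i) ≤ ∑ i ∈ I s, P (E s i) := measure_biUnion_finset_le _ _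
        _ ≤ ∑ i ∈ I s, ENNReal.ofReal (Real.exp (-c * (s : ℝ) ^ β)) :=
            Finset.sum_le_sum (hs₀ s hs).2
        _ = ENNReal.ofReal ((I s).card * Real.exp (-c * (s : ℝ) ^ β)) := by
            rw [Finset.sum_const, nsmul_eq_mul, ENNReal.ofReal_mul (by positivity),
              ENNReal.ofReal_natCast]
        _ ≤ _ := by
            rw [← mul_assoc]
            exact ENNReal.ofReal_le_ofReal
              (mul_le_mul_of_nonneg_right (hs₀ s hs).1 (Real.exp_pos _).le)
    · simp [hB, hs]
  have hsum := ((summable_pow_mul_exp_neg_rpow m hc hβ).mul_left K).tsum_ofReal_ne_top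
  have := ae_eventually_notMem (ne_top_of_le_ne_top hsum (ENNReal.tsum_le_tsum hle))
  filter_upwards [this] with ω hω
  filter_upwards [hω, eventually_ge_atTop s₀] with s hs hss i hi hmem
  simp only [hB, hss, if_true] at hs
  exact hs (Set.mem_biUnion hi hmem)

/-- A bound on `P (H ∈ B w)`, uniform in `w ∈ G`, passes to a random `w = Y` independent
of `H`. -/
theorem measure_mem_random_le [IsProbabilityMeasure P] {ι β : Type*} [MeasurableSpace ι]
    [Countable ι] [MeasurableSingletonClass ι] [MeasurableSpace β] {H : Ω → β} {Y : Ω → ι}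
    (hind : IndepFun H Y P) (hY : Measurable Y) {G : Set ι} {B : ι → Set β}
    (hB : ∀ w, MeasurableSet (B w)) {q : ENNReal} (hq : ∀ w ∈ G, P (H ⁻¹' B w) ≤ q) :
    P {ω | Y ω ∈ G ∧ H ω ∈ B (Y ω)} ≤ q := by
  classical
  have hsub : {ω | Y ω ∈ G ∧ H ω ∈ B (Y ω)}
      ⊆ ⋃ w, (H ⁻¹' (if w ∈ G then B w else ∅) ∩ Y ⁻¹' {w}) := fun ω hω => by
    have h1 : Y ω ∈ G := hω.1
    exact Set.mem_iUnion.2 ⟨Y ω, by simpa [h1] using hω.2, rfl⟩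
  calc P {ω | Y ω ∈ G ∧ H ω ∈ B (Y ω)}
      ≤ ∑' w, P (H ⁻¹' (if w ∈ G then B w else ∅) ∩ Y ⁻¹' {w}) :=
        (measure_mono hsub).trans (measure_iUnion_le _)
    _ ≤ ∑' w, q * P (Y ⁻¹' {w}) := ENNReal.tsum_le_tsum fun w => by
        rw [hind.measure_inter_preimage_eq_mul _ _
          (by split_ifs; exacts [hB w, MeasurableSet.empty]) (measurableSet_singleton w)]
        refine mul_le_mul_left ?_ _
        split_ifs with hw
        · exact hq w hw
        · simp
    _ = q * P (⋃ w, Y ⁻¹' {w}) := by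
        rw [ENNReal.tsum_mul_left, measure_iUnion _ fun w => hY (measurableSet_singleton w)]
        intro w w' hne
        exact Disjoint.preimage _ (Set.disjoint_singleton.2 hne)
    _ ≤ q := mul_le_of_le_one_right' prob_le_one

end BorelCantelli

/-! ### Spreading sites at all large scales -/

/-- The sites whose coordinates lie in `[-R, R]`. -/
noncomputable def box (d R : ℕ) : Finset (Site d) :=
  Fintype.piFinset fun _ => Finset.Icc (-(R : ℤ)) R

theorem mem_box {d R : ℕ} {x : Site d} : x ∈ box d R ↔ ∀ j, (x j).natAbs ≤ R := by
  simp only [box, Fintype.mem_piFinset, Finset.mem_Icc]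
  exact forall_congr' fun j => by omega

theorem card_box (d R : ℕ) : (box d R).card = (2 * R + 1) ^ d := by
  rw [box, Fintype.card_piFinset_const, Int.card_Icc]
  congr 1
  omega

theorem card_box_le {d K m s : ℕ} (hs : 0 < s) :
    (box d (K * s ^ m)).card ≤ (2 * K + 1) ^ d * s ^ (m * d) := by
  rw [card_box, pow_mul, ← mul_pow]
  refine Nat.pow_le_pow_left ?_ d
  have : 0 < s ^ m := by positivity
  nlinarith

section FrogSystem

variable {d : ℕ} {Ω : Type*} [MeasurableSpace Ω] {P : Measure Ω} {ν : Measure ℕ}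
  {η : Site d → Ω → ℕ} {X : Site d → ℕ → ℕ → Ω → Site d} [IsProbabilityMeasure P]

namespace IsFrogSystem

theorem ae_eventually_spreads (hsys : IsFrogSystem P ν η X) (hd : 0 < d) (M : ℕ) {C : ℕ}
    (hC : 0 < C) :
    ∀ᵐ ω ∂P, ∀ᶠ s : ℕ in atTop, ∀ y ∈ box d (2 * s ^ M), (2 * d) ^ (2 * (C * s)) ≤ η y ω →
      Spreads η X (C * s) y ω := by
  classical
  have h := ae_eventually_forall_notMem (P := P)
    (fun s => (box d (2 * s ^ M) ×ˢ box d (C * s ^ 1)).filter fun p => norm1 p.2 ≤ C * s)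
    (fun s p => {ω | ∀ i < (2 * d) ^ (2 * (C * s)), walk X p.1 i (norm1 p.2) ω ≠ p.1 + p.2})
    (K := (((2 * 2 + 1) ^ d * (2 * C + 1) ^ d : ℕ) : ℝ)) (m := M * d + 1 * d)
    ?_ one_pos one_pos ?_
  · filter_upwards [h] with ω hω
    filter_upwards [hω] with s hs y hy hrich z hz
    have hmem : (y, z - y) ∈
        (box d (2 * s ^ M) ×ˢ box d (C * s ^ 1)).filter fun p => norm1 p.2 ≤ C * s := by
      rw [Finset.mem_filter, Finset.mem_product]
      refine ⟨⟨hy, mem_box.2 fun j => ?_⟩, hz⟩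
      rw [pow_one]
      exact (natAbs_le_norm1 _ j).trans hz
    have := hs _ hmem
    simp only [not_forall, not_not] at this
    obtain ⟨i, hi, hw⟩ := this
    exact hitTime_le (hi.trans_le hrich) (by rw [hw]; simp)
  · filter_upwards [eventually_gt_atTop 0] with s hs
    have h1 := Finset.card_filter_le (box d (2 * s ^ M) ×ˢ box d (C * s ^ 1))
      fun p => norm1 p.2 ≤ C * s
    rw [Finset.card_product] at h1
    have h2 := h1.trans (Nat.mul_le_mul (card_box_le hs) (card_box_le hs))
    rw [mul_mul_mul_comm, ← pow_add] at h2
    exact_mod_cast h2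
  · refine Eventually.of_forall fun s p hp => ?_
    refine (hsys.measure_no_particle_le hd p.1 p.2 (Finset.mem_filter.1 hp).2).trans
      (ENNReal.ofReal_le_ofReal (Real.exp_le_exp.2 ?_))
    rw [Real.rpow_one, neg_one_mul, neg_le_neg_iff]
    exact_mod_cast Nat.le_mul_of_pos_left s hC

variable [IsProbabilityMeasure ν] {δ : ℝ}

theorem ae_eventually_exists_rich (hsys : IsFrogSystem P ν η X) (hδd : δ < (d : ℝ))
    (htail : ∀ᶠ n : ℕ in atTop, (n : ℝ) ^ (-δ) ≤ ν.real {m : ℕ | (2 * d) ^ n ≤ m})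
    (M : ℕ) {C : ℕ} (hC : 0 < C) :
    ∀ᵐ ω ∂P, ∀ᶠ s : ℕ in atTop, ∀ x ∈ box d (1 * s ^ M),
      ∃ y, (∀ j, x j ≤ y j ∧ y j < x j + s) ∧ (2 * d) ^ (2 * (C * s)) ≤ η y ω := by
  have h := ae_eventually_forall_notMem (P := P) (fun s => box d (1 * s ^ M))
    (fun s x => {ω | ∀ y ∈ Fintype.piFinset fun j => Finset.Ico (x j) (x j + s),
      η y ω < (2 * d) ^ (2 * (C * s))})
    (K := (((2 * 1 + 1) ^ d : ℕ) : ℝ)) (m := M * d) (c := (2 * C : ℝ) ^ (-δ))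
    (β := (d : ℝ) - δ) ?_ (by positivity) (sub_pos.2 hδd) ?_
  · filter_upwards [h] with ω hω
    filter_upwards [hω] with s hs x hx
    have := hs x hx
    simp only [not_forall, not_lt] at this
    obtain ⟨y, hy, hrich⟩ := this
    exact ⟨y, fun j => Finset.mem_Ico.1 (Fintype.mem_piFinset.1 hy j), hrich⟩
  · filter_upwards [eventually_gt_atTop 0] with s hs
    exact_mod_cast card_box_le hs
  · filter_upwards [hsys.eventually_measure_forall_lt_le htail hC] with s hs x _
    refine hs _ ?_
    rw [Fintype.card_piFinset]
    simp

/-- At every large scale `s`, every site in a box of polynomial size has a spreading site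
within distance `d * s`. -/
theorem ae_eventually_exists_spreads (hsys : IsFrogSystem P ν η X) (hd : 0 < d)
    (hδd : δ < (d : ℝ))
    (htail : ∀ᶠ n : ℕ in atTop, (n : ℝ) ^ (-δ) ≤ ν.real {m : ℕ | (2 * d) ^ n ≤ m})
    {M : ℕ} (hM : 0 < M) {C : ℕ} (hC : 0 < C) :
    ∀ᵐ ω ∂P, ∀ᶠ s : ℕ in atTop, ∀ x ∈ box d (s ^ M),
      ∃ y, norm1 (y - x) ≤ d * s ∧ Spreads η X (C * s) y ω := by
  filter_upwards [hsys.ae_eventually_spreads hd M hC,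
    hsys.ae_eventually_exists_rich hδd htail M hC] with ω h1 h2
  filter_upwards [h1, h2] with s hs1 hs2 x hx
  obtain ⟨y, hy, hrich⟩ := hs2 x (by rwa [one_mul])
  refine ⟨y, ?_, hs1 y (mem_box.2 fun j => ?_) hrich⟩
  · calc norm1 (y - x) ≤ ∑ _j : Fin d, s := Finset.sum_le_sum fun j _ => by
          have := hy j
          rw [Pi.sub_apply]
          omega
      _ = d * s := by simp
  · have h3 := hy j
    have h4 := mem_box.1 hx j
    have h5 : s ≤ s ^ M := Nat.le_self_pow hM.ne' s
    omega

/-- A single particle of the origin meets, at every large scale `s` and at a polynomial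
distance, a site with at least `(2 * d) ^ (2 * C * s)` particles. -/
theorem ae_eventually_exists_walk_rich (hsys : IsFrogSystem P ν η X) (hd : 0 < d)
    (hδd : δ < (d : ℝ))
    (htail : ∀ᶠ n : ℕ in atTop, (n : ℝ) ^ (-δ) ≤ ν.real {m : ℕ | (2 * d) ^ n ≤ m})
    {C : ℕ} (hC : 0 < C) :
    ∀ᵐ ω ∂P, ∀ᶠ s : ℕ in atTop, ∃ m, walk X 0 0 m ω ∈ box d (s ^ (8 * d)) ∧
      (2 * d) ^ (2 * (C * s)) ≤ η (walk X 0 0 m ω) ω := by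
  classical
  -- by time `(s ^ d + 1) ^ 4` the particle has visited more than `s ^ d` sites, up to an event
  -- of probability `O (s ^ (-2))`
  set n : ℕ → ℕ := fun s => (s ^ d + 1) ^ 4 with hn
  have hexit : ∀ᵐ ω ∂P, ∀ᶠ s : ℕ in atTop, ω ∉
      {ω | ((Finset.range (n s + 1)).image fun m => walk X 0 0 m ω).card ≤ s ^ d} := by
    refine ae_eventually_notMem ?_
    have hsum : Summable fun s : ℕ => (d : ℝ) * (((s + 1 : ℕ) : ℝ) ^ 2)⁻¹ :=
      ((summable_nat_add_iff 1).2 (Real.summable_nat_pow_inv.2 one_lt_two)).mul_left _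
    refine ne_top_of_le_ne_top hsum.tsum_ofReal_ne_top (ENNReal.tsum_le_tsum fun s => ?_)
    refine (hsys.measure_card_range_le hd 0 0 (by positivity)).trans (ENNReal.ofReal_le_ofReal ?_)
    have h1 : (s : ℝ) ≤ (s : ℝ) ^ d := by exact_mod_cast Nat.le_self_pow hd.ne' s
    have h2 : (d : ℝ) * (((s ^ d : ℕ) : ℝ) + 1) ^ 2 / (n s : ℝ)
        = d * (((s : ℝ) ^ d + 1) ^ 2)⁻¹ := by
      simp only [hn]
      push_cast
      have : (0 : ℝ) < (s : ℝ) ^ d + 1 := by positivity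
      field_simp
    rw [h2]
    push_cast
    gcongr
  have hrich := ae_eventually_forall_notMem (P := P) (fun _ => ({()} : Finset Unit))
    (fun s _ => {ω | s ^ d < ((Finset.range (n s + 1)).image fun m => walk X 0 0 m ω).card ∧
      ∀ y ∈ (Finset.range (n s + 1)).image fun m => walk X 0 0 m ω,
        η y ω < (2 * d) ^ (2 * (C * s))})
    (K := 1) (m := 0) (c := (2 * C : ℝ) ^ (-δ)) (β := (d : ℝ) - δ) (by simp) (by positivity)
    (sub_pos.2 hδd) ?_
  · filter_upwards [hexit, hrich, hsys.ae_norm1_step] with ω h1 h2 h3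
    filter_upwards [h1, h2, eventually_ge_atTop 2] with s hs1 hs2 hs3
    have hs2' := hs2 () (Finset.mem_singleton_self _)
    simp only [not_le, not_and, not_forall, not_lt] at hs1 hs2'
    obtain ⟨y, hy, hyr⟩ := hs2' hs1
    obtain ⟨m, hm, rfl⟩ := Finset.mem_image.1 hy
    refine ⟨m, mem_box.2 fun j => ?_, hyr⟩
    have h4 : norm1 (walk X 0 0 m ω) ≤ m := by
      rw [walk, zero_add]
      simpa using norm1_sum_le (s := Finset.range m) (f := fun k => X 0 0 k ω)
        fun k _ => (h3 0 0 k).le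
    have h5 : n s ≤ s ^ (8 * d) := by
      have h6 : 2 ≤ s ^ d := hs3.trans (Nat.le_self_pow hd.ne' s)
      calc n s ≤ (s ^ d * s ^ d) ^ 4 := Nat.pow_le_pow_left (by nlinarith) 4
        _ = s ^ (8 * d) := by ring
    have := Finset.mem_range.1 hm
    exact (natAbs_le_norm1 _ j).trans (h4.trans (by omega))
  · filter_upwards [hsys.eventually_measure_forall_lt_le htail hC] with s hs _ _
    -- condition on the trajectory, which is independent of the particle numbers
    let W : (Fin (n s + 1) → Site d) → Finset (Site d) := fun w => Finset.univ.image w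
    let ψ : (Site d × ℕ × ℕ → Site d) → Fin (n s + 1) → Site d :=
      fun u m => ∑ k ∈ Finset.range m, u (0, 0, k)
    have hψ : Measurable ψ := measurable_pi_lambda _ fun m =>
      Finset.measurable_fun_sum _ fun k _ => measurable_pi_apply _
    have hstep : Measurable fun ω (p : Site d × ℕ × ℕ) => X p.1 p.2.1 p.2.2 ω :=
      measurable_pi_lambda _ fun p => hsys.measurable_step _ _ _
    have hind := hsys.indep_count_step.comp (φ := id) measurable_id hψ
    have h := measure_mem_random_le hind (hψ.comp hstep) (G := {w | s ^ d < (W w).card})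
      (B := fun w => {u | ∀ y ∈ W w, u y < (2 * d) ^ (2 * (C * s))}) (fun w => by
        simp only [Set.ofPred_forall]
        exact MeasurableSet.iInter fun y => MeasurableSet.iInter fun _ =>
          measurableSet_lt (measurable_pi_apply y) measurable_const)
      fun w hw => hs (W w) (le_of_lt hw)
    refine le_trans (measure_mono fun ω hω => ?_) h
    have hW : W (ψ fun p => X p.1 p.2.1 p.2.2 ω)
        = (Finset.range (n s + 1)).image fun m => walk X 0 0 m ω := by
      ext y
      simp only [W, ψ, Finset.mem_image, Finset.mem_univ, true_and, Finset.mem_range, walk,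
        zero_add]
      exact ⟨fun ⟨m, hm⟩ => ⟨m, m.2, hm⟩, fun ⟨m, hm, hy⟩ => ⟨⟨m, hm⟩, hy⟩⟩
    simp only [Set.mem_ofPred_eq, Function.comp, id, hW]
    exact hω

/-! ### The shape -/

/-- The lower bound on the speed: almost surely the `ℓ¹` ball of radius `(1 - ε) n` is awake at
every large time `n`. -/
theorem ae_eventually_passageTime_le (hsys : IsFrogSystem P ν η X) (hd : 0 < d)
    (hδd : δ < (d : ℝ))
    (htail : ∀ᶠ n : ℕ in atTop, (n : ℝ) ^ (-δ) ≤ ν.real {m : ℕ | (2 * d) ^ n ≤ m})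
    (hpos : ∀ᵐ m ∂ν, 1 ≤ m) {ε : ℝ} (hε : 0 < ε) :
    ∀ᵐ ω ∂P, ∀ᶠ n : ℕ in atTop, ∀ z : Site d, (norm1 z : ℝ) ≤ (1 - ε) * n →
      passageTime η X 0 z ω ≤ n := by
  obtain ⟨C, hC1, hC2⟩ : ∃ C : ℕ, 3 * d ≤ C ∧ 20 * (d : ℝ) / ε ≤ C := by
    obtain ⟨C, hC⟩ := exists_nat_ge (20 * (d : ℝ) / ε)
    exact ⟨max C (3 * d), le_max_right _ _, hC.trans (by exact_mod_cast le_max_left _ _)⟩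
  have hC0 : 0 < C := by omega
  have hη0 : ∀ᵐ ω ∂P, 1 ≤ η 0 ω := by
    rw [← hsys.law_count 0] at hpos
    exact ae_of_ae_map (hsys.measurable_count 0).aemeasurable hpos
  filter_upwards [hη0, hsys.ae_eventually_exists_walk_rich hd hδd htail hC0,
    hsys.ae_eventually_spreads hd (8 * d) hC0,
    hsys.ae_eventually_exists_spreads hd hδd htail (M := 8 * d) (by omega) hC0]
    with ω h0 h1 h2 h3
  obtain ⟨s₁, hs₁⟩ := eventually_atTop.1 h3
  obtain ⟨k, ⟨m, hbox, hrich⟩, hk2, hk3, hk4⟩ :=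
    (h1.and (h2.and ((eventually_ge_atTop s₁).and (eventually_gt_atTop 0)))).exists
  set x₀ := walk X 0 0 m ω with hx₀
  have hT : passageTime η X 0 x₀ ω ≤ (m : ℕ) := by
    refine (passageTime_le_add 0 0 x₀).trans ?_
    have := add_le_add (passageTime_zero_le (η := η) (X := X) (ω := ω) (0 : Site d))
      (hitTime_le (η := η) (X := X) (x := 0) (z := x₀) (i := 0) (n := m) (by omega) rfl)
    simpa using this
  have hbox' : ∀ s, k ≤ s → x₀ ∈ box d (s ^ (8 * d)) := fun s hs =>
    mem_box.2 fun j => (mem_box.1 hbox j).trans (Nat.pow_le_pow_left hs _)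
  exact eventually_passageTime_le hC1 hT
    (hk2 x₀ (mem_box.2 fun j => (mem_box.1 hbox j).trans (by omega)) hrich)
    (fun s hs => hs₁ s (hk3.trans hs) x₀ (hbox' s hs)) hd hk4 hε hC2

end IsFrogSystem

end FrogSystem

theorem isCompact_diamond (d : ℕ) : IsCompact (diamond d) := by
  refine Metric.isCompact_of_isClosed_isBounded
    (isClosed_le (by fun_prop) continuous_const) ?_
  refine (Metric.isBounded_closedBall (x := (0 : Fin d → ℝ)) (r := 1)).subset fun x hx => ?_
  rw [mem_closedBall_zero_iff, pi_norm_le_iff_of_nonneg zero_le_one]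
  exact fun j => (Finset.single_le_sum (f := fun j => |x j|) (fun _ _ => abs_nonneg _)
    (Finset.mem_univ j)).trans hx

theorem smul_mem_diamond {d : ℕ} {a : ℝ} (ha : 0 ≤ a) {x : Fin d → ℝ} (h : a * ∑ j, |x j| ≤ 1) :
    a • x ∈ diamond d := by
  simpa [diamond, abs_mul, abs_of_nonneg ha, ← Finset.mul_sum] using h

theorem convex_diamond (d : ℕ) : Convex ℝ (diamond d) := by
  intro x hx y hy a b ha hb hab
  have hx' : ∑ j, |x j| ≤ 1 := hx
  have hy' : ∑ j, |y j| ≤ 1 := hy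
  calc ∑ j, |(a • x + b • y) j| ≤ ∑ j, (a * |x j| + b * |y j|) :=
        Finset.sum_le_sum fun j _ => by
          refine (abs_add_le _ _).trans ?_
          simp [abs_mul, abs_of_nonneg ha, abs_of_nonneg hb]
    _ = a * ∑ j, |x j| + b * ∑ j, |y j| := by
        rw [Finset.sum_add_distrib, Finset.mul_sum, Finset.mul_sum]
    _ ≤ a * 1 + b * 1 := by gcongr
    _ = 1 := by linarith

/-- If `(1 - ε) A ⊆ (1 + ε) B` for all `0 < ε < 1` and `B` is closed, then `A ⊆ B`. -/
theorem subset_of_forall_smul_subset {E : Type*} [AddCommGroup E] [Module ℝ E]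
    [TopologicalSpace E] [ContinuousSMul ℝ E] {A B : Set E} (hB : IsClosed B)
    (h : ∀ ε : ℝ, 0 < ε → ε < 1 → (1 - ε) • A ⊆ (1 + ε) • B) : A ⊆ B := by
  intro x hx
  have hlim : Tendsto (fun ε : ℝ => ((1 + ε)⁻¹ * (1 - ε)) • x) (nhdsWithin 0 (Set.Ioi 0))
      (nhds x) := by
    have h1 : ContinuousAt (fun ε : ℝ => ((1 + ε)⁻¹ * (1 - ε)) • x) 0 := by
      refine ContinuousAt.smul (ContinuousAt.mul (ContinuousAt.inv₀ ?_ (by norm_num)) ?_) ?_ <;>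
        fun_prop
    have h2 := h1.tendsto
    simp only [add_zero, inv_one, sub_zero, mul_one, one_smul] at h2
    exact h2.mono_left nhdsWithin_le_nhds
  refine hB.mem_of_tendsto hlim ?_
  filter_upwards [Ioo_mem_nhdsGT (zero_lt_one (α := ℝ))] with ε hε
  obtain ⟨y, hy, hxy⟩ := h ε hε.1 hε.2 (Set.smul_mem_smul_set hx)
  have h3 : (1 : ℝ) + ε ≠ 0 := by linarith [hε.1]
  rw [mul_smul, ← hxy]
  simpa [inv_smul_smul₀ h3] using hy

section FrogSystem

variable {d : ℕ} {Ω : Type*} [MeasurableSpace Ω] {P : Measure Ω} [IsProbabilityMeasure P]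
  {η : Site d → Ω → ℕ} {X : Site d → ℕ → ℕ → Ω → Site d}

theorem IsAsymptoticShape.subset {A B : Set (Fin d → ℝ)} (hA : IsAsymptoticShape η X P A)
    (hB : IsAsymptoticShape η X P B) : A ⊆ B := by
  refine subset_of_forall_smul_subset hB.2.2.1.isClosed fun ε h0 h1 => ?_
  obtain ⟨ω, hω1, hω2⟩ := ((hA.2.2.2 ε h0 h1).and (hB.2.2.2 ε h0 h1)).exists
  obtain ⟨n, hn1, hn2⟩ := (hω1.and hω2).exists
  exact hn1.1.trans hn2.2

theorem IsFrogSystem.isAsymptoticShape_diamond {ν : Measure ℕ} [IsProbabilityMeasure ν] {δ : ℝ}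
    (hsys : IsFrogSystem P ν η X) (hd : 0 < d) (hδd : δ < (d : ℝ))
    (htail : ∀ᶠ n : ℕ in atTop, (n : ℝ) ^ (-δ) ≤ ν.real {m : ℕ | (2 * d) ^ n ≤ m})
    (hpos : ∀ᵐ m ∂ν, 1 ≤ m) : IsAsymptoticShape η X P (diamond d) := by
  refine ⟨⟨0, by simp [diamond]⟩, convex_diamond d, isCompact_diamond d, fun ε h0 h1 => ?_⟩
  filter_upwards [hsys.ae_eventually_passageTime_le hd hδd htail hpos (half_pos h0),
    hsys.ae_norm1_step] with ω hω hstep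
  have hlim : Tendsto (fun n : ℕ => ε * (n : ℝ)) atTop atTop :=
    tendsto_natCast_atTop_atTop.const_mul_atTop h0
  filter_upwards [hω, hlim.eventually_ge_atTop (d : ℝ), eventually_gt_atTop 0] with n hn hnd hn0
  have hn0' : (0 : ℝ) < n := by exact_mod_cast hn0
  -- rounding moves a point by at most `d / 2` in the `ℓ¹` norm
  have hround : ∀ u v : Fin d → ℝ, (∀ j, |u j - v j| ≤ 1 / 2) →
      ∑ j, |u j| ≤ ∑ j, |v j| + d / 2 := fun u v huv => by
    calc ∑ j, |u j| ≤ ∑ j, (|v j| + 1 / 2) := Finset.sum_le_sum fun j _ => by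
          have := abs_sub_abs_le_abs_sub (u j) (v j)
          linarith [huv j]
      _ = ∑ j, |v j| + d / 2 := by
          rw [Finset.sum_add_distrib]; simp [div_eq_mul_inv]
  constructor
  · rintro _ ⟨u, hu, rfl⟩
    have hu' : ∑ j, |u j| ≤ 1 := hu
    set v : Fin d → ℝ := ((n : ℝ) * (1 - ε)) • u with hv
    set z : Site d := fun j => ⌈v j - 1 / 2⌉ with hz
    have hz1 : ∀ j, v j - 1 / 2 ≤ z j := fun j => Int.le_ceil _
    have hz2 : ∀ j, (z j : ℝ) < v j - 1 / 2 + 1 := fun j => Int.ceil_lt_add_one _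
    refine ⟨v, ⟨z, hn z ?_, fun j => ⟨by linarith [hz2 j], by linarith [hz1 j]⟩⟩, ?_⟩
    · rw [cast_norm1_real]
      refine (hround (fun j => (z j : ℝ)) v fun j => abs_le.2
        ⟨by linarith [hz1 j], by linarith [hz2 j]⟩).trans ?_
      have hc : 0 ≤ (n : ℝ) * (1 - ε) := mul_nonneg hn0'.le (by linarith)
      have h3 : ∑ j, |v j| = (n : ℝ) * (1 - ε) * ∑ j, |u j| := by
        rw [Finset.mul_sum]
        exact Finset.sum_congr rfl fun j _ => by
          rw [hv, Pi.smul_apply, smul_eq_mul, abs_mul, abs_of_nonneg hc]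
      have h4 := mul_le_mul_of_nonneg_left hu' hc
      rw [h3]
      linarith
    · simp only [hv]
      rw [smul_smul, ← mul_assoc, inv_mul_cancel₀ hn0'.ne', one_mul]
  · rintro _ ⟨u, ⟨y, hy, hyu⟩, rfl⟩
    have hy1 : norm1 y ≤ n := by
      have := (norm1_sub_le_passageTime (η := η) hstep 0 y).trans hy
      rw [sub_zero] at this
      exact_mod_cast this
    have hy2 : ∑ j, |(y j : ℝ)| ≤ n := by
      rw [← cast_norm1_real]; exact_mod_cast hy1
    have h3 := hround u (fun j => (y j : ℝ)) fun j => abs_le.2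
      ⟨by linarith [(hyu j).1], by linarith [(hyu j).2]⟩
    have hpos' : 0 < (1 + ε) * (n : ℝ) := by positivity
    refine ⟨((1 + ε) * (n : ℝ))⁻¹ • u, smul_mem_diamond (by positivity) ?_, ?_⟩
    · rw [inv_mul_le_iff₀ hpos']
      linarith
    · simp only
      rw [smul_smul, mul_inv, ← mul_assoc, mul_inv_cancel₀ (by positivity), one_mul]

end FrogSystem

theorem theorem3 {d : ℕ} {Ω : Type*} [MeasurableSpace Ω] (P : Measure Ω) [IsProbabilityMeasure P]
    (ν : Measure ℕ) [IsProbabilityMeasure ν]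
    (η : Site d → Ω → ℕ) (X : Site d → ℕ → ℕ → Ω → Site d) (hsys : IsFrogSystem P ν η X)
    (δ : ℝ) (hδ : 0 < δ) (hδd : δ < (d : ℝ))
    (htail : ∀ᶠ n : ℕ in atTop, (n : ℝ) ^ (-δ) ≤ ν.real {m : ℕ | (2 * d) ^ n ≤ m})
    (hpos : ∀ᵐ m ∂ν, 1 ≤ m) :
    ∀ A : Set (Fin d → ℝ), IsAsymptoticShape η X P A ↔ A = diamond d := by
  have hd : 0 < d := by exact_mod_cast hδ.trans hδd
  have hD := hsys.isAsymptoticShape_diamond hd hδd htail hpos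
  intro A
  constructor
  · intro hA
    exact (hA.subset hD).antisymm (hD.subset hA)
  · rintro rfl
    exact hD
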